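/- Let $l\ge 0$ be an integer. (1) Let $c_{ij}$ ($1\le i\le l$, $j=1,2$) be integers with $c_{i1}+c_{i2}\ge 0$ for all $i$, and let $$\mathcal A=\begin{pmatrix} c_{11}&c_{21}&\dots&c_{l1}&c_{l2}&\dots&c_{22}&c_{12}\\ c_{12}&c_{22}&\dots&c_{l2}&c_{l1}&\dots&c_{21}&c_{11}\end{pmatrix}.$$ Let $\mathcal M_{\mathcal A}$ be the set of all $\mu=(\mu_1,\dots,\mu_{2l})\in\mathbb N^{2l}$ (where $0\in\mathbb N$) such that $\mathcal A\mu^t=(k,k)^t$ for some $k\in\mathbb N$; put $\bar\mu=(\mu_{2l},\dots,\mu_1)$ and $$I_{\mathcal A}=\langle x^\mu-x^{\bar\mu}\mid \mu\in\mathcal M_{\mathcal A}\rangle\subset\mathbb C[x_1,\dots,x_{2l}].$$ Then the affine variety $\mathbf V(I_{\mathcal A})\subset\mathbb C^{2l}$ has dimension $l$ if $c_{i1}=c_{i2}$ for all $i=1,\dots,l$, and dimension $l+1$ otherwise. (The dimension of an affine variety $V$ is the Krull dimension of its coordinate ring, the polynomial ring modulo the ideal of all polynomials vanishing on $V$.)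 (2) Let $S=\{(p_1,q_1),\dots,(p_l,q_l)\}\subset(\{-1\}\cup\mathbb N)\times\mathbb N$ be a set of $l$ distinct pairs with $p_i+q_i\ge 1$ for all $i$, and consider the family of polynomial systems $$\frac{dx}{d\tau}=x-\sum_{(p,q)\in S}a_{pq}x^{p+1}y^q,\qquad -\frac{dy}{d\tau}=y-\sum_{(p,q)\in S}b_{qp}x^qy^{p+1}$$ with parameter space $\mathbb C^{2l}$. Let $\mathcal M$ be the set of all $\nu\in\mathbb N^{2l}$ such that $$\binom{p_1}{q_1}\nu_1+\dots+\binom{p_l}{q_l}\nu_l+\binom{q_l}{p_l}\nu_{l+1}+\dots+\binom{q_1}{p_1}\nu_{2l}=\binom kk$$ for some $k\in\mathbb N$, let $[\nu]=a_{p_1q_1}^{\nu_1}\cdots a_{p_lq_l}^{\nu_l}b_{q_lp_l}^{\nu_{l+1}}\cdots b_{q_1p_1}^{\nu_{2l}}$, and let $I_{sym}=\langle[\nu]-[\bar\nu]\mid\nu\in\mathcal M\rangle\subset\mathbb C[a,b]$ be the Sibirsky ideal. Then the symmetry component $\mathbf V(I_{sym})\subset\mathbb C^{2l}$ has dimension $l$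 if all coefficients of the system are resonant, that is, of the form $a_{kk},b_{kk}$ (equivalently $p_i=q_i$ for all $i$), and dimension $l+1$ otherwise. -/

import Mathlib

open scoped Matrix

/-- The dimension of an affine variety `V` in `ℂ^σ`: the Krull dimension of its coordinate
ring `ℂ[x] / I(V)`, where `I(V)` is the ideal of all polynomials vanishing on `V`. -/
noncomputable def varietyDim {σ : Type} (V : Set (σ → ℂ)) : WithBot ℕ∞ :=
  ringKrullDim (MvPolynomial σ ℂ ⧸ MvPolynomial.vanishingIdeal ℂ V)

/-- The monomial `x₁^ν₁ ⋯ x_d^ν_d`, with coefficient 1. -/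
noncomputable def expMonomial {d : ℕ} (ν : Fin d → ℕ) : MvPolynomial (Fin d) ℂ :=
  ∏ j, MvPolynomial.X j ^ ν j

/-- The reversal `ν̄ = (ν_d, …, ν₁)` of `ν = (ν₁, …, ν_d)`. -/
def revExp {d : ℕ} (ν : Fin d → ℕ) : Fin d → ℕ := fun j => ν j.rev

/-- The ideal of `ℂ[x₁, …, x_d]` generated by all binomials `x^ν - x^ν̄` with `ν ∈ M`. -/
noncomputable def reversalIdeal {d : ℕ} (M : Set (Fin d → ℕ)) : Ideal (MvPolynomial (Fin d) ℂ) :=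
  Ideal.span {f | ∃ ν ∈ M, f = expMonomial ν - expMonomial (revExp ν)}

/-- The `2 × 2l` matrix with rows `c₁₁ c₂₁ … c_l1 c_l2 … c₂₂ c₁₂` and
`c₁₂ c₂₂ … c_l2 c_l1 … c₂₁ c₁₁`. The entry `c_{ij}` is `c i (j - 1)`, since `Fin 2 = {0, 1}`. -/
def coeffMatrix {l : ℕ} (c : Fin l → Fin 2 → ℤ) : Matrix (Fin 2) (Fin (l + l)) ℤ :=
  Matrix.of fun r => Fin.append (fun i => c i r) (fun i => c i.rev r.rev)

/-- The monoid `M_A`: all `ν ∈ ℕ^{2l}` with `A ν = (k, k)` for some `k ∈ ℕ`. -/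
def matrixMonoid {l : ℕ} (c : Fin l → Fin 2 → ℤ) : Set (Fin (l + l) → ℕ) :=
  {ν | ∃ k : ℕ, coeffMatrix c *ᵥ (fun j => (ν j : ℤ)) = ![(k : ℤ), (k : ℤ)]}

/-- The ideal `I_A = ⟨x^μ - x^μ̄ | μ ∈ M_A⟩` of `ℂ[x₁, …, x_{2l}]`. -/
noncomputable def matrixIdeal {l : ℕ} (c : Fin l → Fin 2 → ℤ) :
    Ideal (MvPolynomial (Fin (l + l)) ℂ) :=
  reversalIdeal (matrixMonoid c)

/-- An enumeration `(p₁, q₁), …, (p_l, q_l)` of the `l`-element set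
`S ⊆ ({-1} ∪ ℕ) × ℕ`, with `pᵢ + qᵢ ≥ 1`, of exponents of the polynomial system
`dx/dτ = x - ∑_{(p,q) ∈ S} a_{pq} x^{p+1} y^q`,
`-dy/dτ = y - ∑_{(p,q) ∈ S} b_{qp} x^q y^{p+1}`. -/
structure SystemIndex (l : ℕ) where
  p : Fin l → ℤ
  q : Fin l → ℕ
  neg_one_le_p : ∀ i, -1 ≤ p i
  one_le_add : ∀ i, 1 ≤ p i + q i
  injective : Function.Injective fun i => (p i, q i)

namespace SystemIndex

variable {l : ℕ} (S : SystemIndex l)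

/-- The operator `L(ν) = ∑_{i=1}^{l} (pᵢ, qᵢ) νᵢ + (q_l, p_l) ν_{l+1} + ⋯ + (q₁, p₁) ν_{2l}`. -/
def opL (ν : Fin (l + l) → ℕ) : ℤ × ℤ :=
  ∑ i : Fin l, ν (Fin.castAdd l i) • (S.p i, (S.q i : ℤ)) +
    ∑ i : Fin l, ν (Fin.natAdd l i) • ((S.q i.rev : ℤ), S.p i.rev)

/-- The monoid of all `ν ∈ ℕ^{2l}` with `L(ν) = (k, k)` for some `k ∈ ℕ`. -/
def monoid : Set (Fin (l + l) → ℕ) :=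
  {ν | ∃ k : ℕ, S.opL ν = ((k : ℤ), (k : ℤ))}

/-- The Sibirsky ideal `I_sym = ⟨[ν] - [ν̄]⟩` of `ℂ[a, b]`. The `2l` variables are taken in the
order `a_{p₁q₁}, …, a_{p_l q_l}, b_{q_l p_l}, …, b_{q₁p₁}`, so that `[ν]` is the monomial with
exponents `ν₁, …, ν_{2l}`. -/
noncomputable def sibirskyIdeal : Ideal (MvPolynomial (Fin (l + l)) ℂ) :=
  reversalIdeal S.monoid

/-- The symmetry component `V(I_sym)` in the parameter space `E(a, b) = ℂ^{2l}`. -/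
noncomputable def symmetryComponent : Set (Fin (l + l) → ℂ) :=
  MvPolynomial.zeroLocus ℂ S.sibirskyIdeal

/-- All coefficients `a_{pᵢqᵢ}`, `b_{qᵢpᵢ}` are resonant, i.e. of the form `a_{kk}`, `b_{kk}`. -/
def AllResonant : Prop := ∀ i, S.p i = S.q i

end SystemIndex

/-! The ideal is toric. Let `δ` be the difference of the two rows; reversal negates it. Then `I_A`
is the kernel of the monomial map `x_j ↦ s ^ max(δ_j, 0) * t_{fold j}`, where `s` is omitted if `δ =
0` (`matrixIdeal_eq_ker`). Hence `I_A` is prime, and by the Nullstellensatz the coordinate ring is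
the image of that map. The whole polynomial ring in the parameters is algebraic over this image, so
the dimension, which equals the transcendence degree, is the number of parameters: `l`, or `l + 1`
when `s` occurs. -/

/-- An injective integral extension preserves the Krull dimension. -/
theorem ringKrullDim_eq_of_isIntegral_of_injective (R S : Type*) [CommRing R] [CommRing S]
    [Algebra R S] [Algebra.IsIntegral R S]
    (hinj : Function.Injective (algebraMap R S)) : ringKrullDim R = ringKrullDim S := by
  refine le_antisymm ?_ (Order.krullDim_le_of_strictMono
    (PrimeSpectrum.comap (algebraMap R S)) fun P Q h => Ideal.IsIntegral.comap_lt_comap h)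
  refine iSup_le fun p => ?_
  -- Lying over supplies a prime above the bottom of the chain, and going up lifts the rest.
  obtain ⟨Q, -, hQ, hQp⟩ := Ideal.exists_ideal_over_prime_of_isIntegral (S := S)
    p.head.asIdeal ⊥ (by
      rw [← RingHom.ker_eq_comap_bot, (RingHom.injective_iff_ker_eq_bot _).mp hinj]
      exact bot_le)
  have : Q.LiesOver p.head.asIdeal := ⟨hQp.symm⟩
  obtain ⟨L, hL, -⟩ := Ideal.exists_ltSeries_of_hasGoingUp p Q
  rw [← hL]
  exact Order.LTSeries.length_le_krullDim L

/-- The Krull dimension of a finitely generated domain over a field is its transcendence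
degree. -/
theorem ringKrullDim_eq_of_trdeg_eq (k A : Type) [Field k] [CommRing A] [IsDomain A] [Algebra k A]
    [Algebra.FiniteType k A] {n : ℕ} (h : Algebra.trdeg k A = n) : ringKrullDim A = n := by
  obtain ⟨s, g, hg, hint⟩ := exists_integral_inj_algHom_of_fg k A
  algebraize [g.toRingHom]
  have : Algebra.IsIntegral (MvPolynomial (Fin s) k) A := ⟨hint⟩
  have : FaithfulSMul (MvPolynomial (Fin s) k) A :=
    (faithfulSMul_iff_algebraMap_injective _ _).mpr hg
  have : IsScalarTower k (MvPolynomial (Fin s) k) A :=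
    IsScalarTower.of_algebraMap_eq fun x => (g.commutes x).symm
  have hadd := trdeg_add_eq k (MvPolynomial (Fin s) k) (A := A)
  rw [MvPolynomial.trdeg_of_isDomain, trdeg_eq_zero, h] at hadd
  have hsn : s = n := by simpa using hadd
  rw [← ringKrullDim_eq_of_isIntegral_of_injective (MvPolynomial (Fin s) k) A hg,
    MvPolynomial.ringKrullDim_of_isNoetherianRing, ringKrullDim_eq_zero_of_field]
  simp [hsn]

/-! ### Kernels of monomial maps -/

section MonomialMap

variable {σ τ : Type} (w : σ → τ →₀ ℕ)

/-- The algebra homomorphism `ℂ[x_σ] → ℂ[t_τ]` that sends each `x_j` to the monomial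
`t ^ (w j)`. -/
noncomputable def monomialMap : MvPolynomial σ ℂ →ₐ[ℂ] MvPolynomial τ ℂ :=
  MvPolynomial.aeval fun j => MvPolynomial.monomial (w j) 1

theorem monomialMap_monomial (e : σ →₀ ℕ) (c : ℂ) :
    monomialMap w (MvPolynomial.monomial e c) =
      MvPolynomial.monomial (Finsupp.linearCombination ℕ w e) c := by
  rw [monomialMap, MvPolynomial.aeval_monomial, Finsupp.linearCombination_apply,
    MvPolynomial.algebraMap_eq]
  simp only [MvPolynomial.monomial_pow, one_pow, Finsupp.prod, Finsupp.sum]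
  rw [← MvPolynomial.monomial_sum_one, MvPolynomial.C_mul_monomial, mul_one]

/-- An ideal that contains all binomials in the kernel of a monomial map contains the kernel. -/
theorem ker_monomialMap_le {I : Ideal (MvPolynomial σ ℂ)}
    (hI : ∀ a b : σ →₀ ℕ, Finsupp.linearCombination ℕ w a = Finsupp.linearCombination ℕ w b →
      MvPolynomial.monomial a (1 : ℂ) - MvPolynomial.monomial b 1 ∈ I) :
    RingHom.ker (monomialMap w) ≤ I := by
  classical
  -- `s` picks one exponent in each nonempty fibre. The linear map `ψ` then replaces a monomial by
  -- the representative of its fibre, which changes it only modulo `I`.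
  let s : (τ →₀ ℕ) → (σ →₀ ℕ) := Function.invFun (Finsupp.linearCombination ℕ w)
  let ψ : MvPolynomial τ ℂ →ₗ[ℂ] MvPolynomial σ ℂ :=
    (MvPolynomial.basisMonomials τ ℂ).constr ℂ fun d => MvPolynomial.monomial (s d) 1
  have hψ (d : τ →₀ ℕ) : ψ (MvPolynomial.monomial d 1) = MvPolynomial.monomial (s d) 1 := by
    simpa using (MvPolynomial.basisMonomials τ ℂ).constr_basis ℂ
      (fun d => MvPolynomial.monomial (s d) (1 : ℂ)) d
  have key (f : MvPolynomial σ ℂ) : f - ψ (monomialMap w f) ∈ I := by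
    induction f using MvPolynomial.induction_on' with
    | monomial e c =>
      rw [← mul_one c, ← smul_eq_mul, ← MvPolynomial.smul_monomial, map_smul, map_smul,
        monomialMap_monomial, hψ, ← smul_sub, MvPolynomial.smul_eq_C_mul]
      exact I.mul_mem_left _ (hI _ _ (Function.invFun_eq ⟨e, rfl⟩).symm)
    | add p q hp hq =>
      rw [map_add, map_add, add_sub_add_comm]
      exact I.add_mem hp hq
  intro f hf
  have hf0 : monomialMap w f = 0 := hf
  simpa [hf0] using key f

/-- The zero locus of the kernel of a monomial map has dimension `n` when the target polynomial
ring in `n` variables is algebraic over the image. -/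
theorem varietyDim_zeroLocus_ker_monomialMap [Finite σ] [Fintype τ]
    (halg : ∀ i : τ, IsAlgebraic (monomialMap w).range (MvPolynomial.X i : MvPolynomial τ ℂ)) :
    varietyDim (MvPolynomial.zeroLocus ℂ (RingHom.ker (monomialMap w))) = Fintype.card τ := by
  have : (RingHom.ker (monomialMap w)).IsPrime := RingHom.ker_isPrime _
  rw [varietyDim, MvPolynomial.IsPrime.vanishingIdeal_zeroLocus]
  have e := Ideal.quotientKerEquivRange (monomialMap w)
  rw [ringKrullDim_eq_of_ringEquiv e.toRingEquiv]
  have : Algebra.FiniteType ℂ (monomialMap w).range :=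
    Algebra.FiniteType.of_surjective (monomialMap w).rangeRestrict
      (monomialMap w).rangeRestrict_surjective
  have : Algebra.IsAlgebraic (monomialMap w).range (MvPolynomial τ ℂ) := by
    refine ⟨fun f => ?_⟩
    induction f using MvPolynomial.induction_on with
    | C c => exact isAlgebraic_algebraMap (algebraMap ℂ (monomialMap w).range c)
    | add p q hp hq => exact hp.add hq
    | mul_X p i hp => exact hp.mul (halg i)
  refine ringKrullDim_eq_of_trdeg_eq ℂ _ ?_
  have hadd := trdeg_add_eq ℂ (monomialMap w).range (A := MvPolynomial τ ℂ)
  rw [trdeg_eq_zero (R := (monomialMap w).range), add_zero,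
    MvPolynomial.trdeg_of_isDomain] at hadd
  simpa using hadd

end MonomialMap

/-! ### The reversal ideal as a toric ideal -/

section ReversalIdeal

variable {l : ℕ} (c : Fin l → Fin 2 → ℤ)

/-- The difference of the two rows of the coefficient matrix. -/
def rowDiff (j : Fin (l + l)) : ℤ := coeffMatrix c 0 j - coeffMatrix c 1 j

theorem rev_castAdd_eq_natAdd (i : Fin l) : (Fin.castAdd l i).rev = Fin.natAdd l i.rev := by
  rw [Fin.rev_castAdd, Fin.natAdd_eq_addNat]

theorem rev_natAdd_eq_castAdd (i : Fin l) : (Fin.natAdd l i).rev = Fin.castAdd l i.rev := by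
  rw [Fin.rev_eq_iff, rev_castAdd_eq_natAdd, Fin.rev_rev]

theorem coeffMatrix_castAdd (r : Fin 2) (i : Fin l) :
    coeffMatrix c r (Fin.castAdd l i) = c i r := by
  simp [coeffMatrix]

theorem coeffMatrix_natAdd (r : Fin 2) (i : Fin l) :
    coeffMatrix c r (Fin.natAdd l i) = c i.rev r.rev := by
  simp only [coeffMatrix, Matrix.of_apply, Fin.append_right]

theorem rowDiff_rev (j : Fin (l + l)) : rowDiff c j.rev = -rowDiff c j := by
  refine Fin.addCases (fun i => ?_) (fun i => ?_) j
  · rw [rev_castAdd_eq_natAdd, rowDiff, rowDiff]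
    simp [coeffMatrix_castAdd, coeffMatrix_natAdd, -Fin.natAdd_eq_addNat]
  · rw [rev_natAdd_eq_castAdd, rowDiff, rowDiff]
    simp [coeffMatrix_castAdd, coeffMatrix_natAdd, -Fin.natAdd_eq_addNat]

theorem sum_comp_rev {M : Type*} [AddCommMonoid M] {d : ℕ} (f : Fin d → M) :
    ∑ j : Fin d, f j.rev = ∑ j, f j :=
  Equiv.sum_comp Fin.revPerm f

/-- Column sums are nonnegative, so once the two rows agree on `ν` their common value is
automatically a natural number. -/
theorem mem_matrixMonoid_iff (hc : ∀ i, 0 ≤ c i 0 + c i 1) (ν : Fin (l + l) → ℕ) :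
    ν ∈ matrixMonoid c ↔ ∑ j, rowDiff c j * ν j = 0 := by
  have hmul (r : Fin 2) : (coeffMatrix c *ᵥ (fun j => (ν j : ℤ))) r =
      ∑ j, coeffMatrix c r j * ν j := rfl
  have hsub : ∑ j, rowDiff c j * (ν j : ℤ) =
      ∑ j, coeffMatrix c 0 j * (ν j : ℤ) - ∑ j, coeffMatrix c 1 j * (ν j : ℤ) := by
    simp only [rowDiff, sub_mul, Finset.sum_sub_distrib]
  constructor
  · rintro ⟨k, hk⟩
    have h0 := congrFun hk 0
    have h1 := congrFun hk 1
    rw [hmul] at h0 h1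
    rw [hsub, h0, h1]
    simp
  · intro h
    rw [hsub, sub_eq_zero] at h
    have hnonneg : 0 ≤ ∑ j, (coeffMatrix c 0 j + coeffMatrix c 1 j) * (ν j : ℤ) := by
      refine Finset.sum_nonneg fun j _ => mul_nonneg ?_ (Int.natCast_nonneg _)
      refine Fin.addCases (fun i => ?_) (fun i => ?_) j
      · simpa [coeffMatrix_castAdd] using hc i
      · simpa [coeffMatrix_natAdd, -Fin.natAdd_eq_addNat, add_comm] using hc i.rev
    simp only [add_mul, Finset.sum_add_distrib] at hnonneg
    refine ⟨(∑ j, coeffMatrix c 0 j * (ν j : ℤ)).toNat, ?_⟩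
    have hk := Int.toNat_of_nonneg (a := ∑ j, coeffMatrix c 0 j * (ν j : ℤ)) (by lia)
    funext r
    fin_cases r
    · simpa [hmul] using hk.symm
    · simpa [hmul] using h.symm.trans hk.symm

theorem expMonomial_eq_monomial {d : ℕ} (ν : Fin d → ℕ) :
    expMonomial ν = MvPolynomial.monomial (Finsupp.equivFunOnFinite.symm ν) (1 : ℂ) := by
  rw [MvPolynomial.monomial_eq, Finsupp.prod_fintype _ _ (fun _ => pow_zero _)]
  simp [expMonomial]

theorem expMonomial_add {d : ℕ} (μ ν : Fin d → ℕ) :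
    expMonomial (μ + ν) = expMonomial μ * expMonomial ν := by
  simp [expMonomial, pow_add, Finset.prod_mul_distrib]

/-- Two exponents with equal totals on each pair of reversed positions and equal weights differ
by a binomial of the ideal `I_A`. -/
theorem expMonomial_sub_mem_matrixIdeal (hc : ∀ i, 0 ≤ c i 0 + c i 1) {a b : Fin (l + l) → ℕ}
    (hpair : ∀ j, a j + a j.rev = b j + b j.rev)
    (hweight : ∑ j, rowDiff c j * a j = ∑ j, rowDiff c j * b j) :
    expMonomial a - expMonomial b ∈ matrixIdeal c := by
  -- Subtraction is truncated. Equal pair totals turn an excess of `a` at `j` into an equal excess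
  -- of `b` at `j.rev`, so `b - a` is the reversal of `a - b`.
  have ha : a = a ⊓ b + (a - b) := by
    funext j
    simp only [Pi.add_apply, Pi.inf_apply, Pi.sub_apply]
    lia
  have hb : b = a ⊓ b + revExp (a - b) := by
    funext j
    have := hpair j
    simp only [Pi.add_apply, Pi.inf_apply, Pi.sub_apply, revExp]
    lia
  have hmem : a - b ∈ matrixMonoid c := by
    rw [mem_matrixMonoid_iff c hc]
    -- Equal weights of `a` and `b` thus say that twice the weight of `a - b` is zero.
    have hrev : ∑ j, rowDiff c j * ((a - b) j.rev : ℕ) = -∑ j, rowDiff c j * ((a - b) j : ℕ) := by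
      rw [← sum_comp_rev, ← Finset.sum_neg_distrib]
      simp [rowDiff_rev]
    have hdiff : ∑ j, rowDiff c j * ((a - b) j : ℕ) - ∑ j, rowDiff c j * ((a - b) j.rev : ℕ) =
        ∑ j, rowDiff c j * (a j : ℤ) - ∑ j, rowDiff c j * (b j : ℤ) := by
      rw [← Finset.sum_sub_distrib, ← Finset.sum_sub_distrib]
      refine Finset.sum_congr rfl fun j _ => ?_
      rw [← mul_sub, ← mul_sub]
      congr 1
      have := hpair j
      simp only [Pi.sub_apply]
      lia
    lia
  have : expMonomial a - expMonomial b =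
      expMonomial (a ⊓ b) * (expMonomial (a - b) - expMonomial (revExp (a - b))) := by
    rw [mul_sub, ← expMonomial_add, ← expMonomial_add, ← ha, ← hb]
  rw [this]
  exact Ideal.mul_mem_left _ _ (Ideal.subset_span ⟨_, hmem, rfl⟩)

/-- The index of the pair of reversed positions that contains `j`. -/
def foldIndex : Fin (l + l) → Fin l := Fin.append id Fin.rev

theorem foldIndex_rev (j : Fin (l + l)) : foldIndex j.rev = foldIndex j := by
  refine Fin.addCases (fun i => ?_) (fun i => ?_) j
  · simp [rev_castAdd_eq_natAdd, foldIndex, -Fin.natAdd_eq_addNat]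
  · simp [rev_natAdd_eq_castAdd, foldIndex, -Fin.natAdd_eq_addNat]

theorem sum_ite_foldIndex (a : Fin (l + l) → ℕ) (j : Fin (l + l)) :
    (∑ k, if foldIndex k = foldIndex j then a k else 0) = a j + a j.rev := by
  rw [Fin.sum_univ_add]
  refine Fin.addCases (fun i => ?_) (fun i => ?_) j
  · simp [rev_castAdd_eq_natAdd, foldIndex, -Fin.natAdd_eq_addNat, Fin.rev_eq_iff]
  · simp [rev_natAdd_eq_castAdd, foldIndex, -Fin.natAdd_eq_addNat, add_comm]

theorem matrixIdeal_eq_ker {τ : Type} (w : Fin (l + l) → τ →₀ ℕ)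
    (hc : ∀ i, 0 ≤ c i 0 + c i 1)
    (hw : ∀ a b : Fin (l + l) → ℕ, ∑ j, a j • w j = ∑ j, b j • w j ↔
      (∀ j, a j + a j.rev = b j + b j.rev) ∧
        ∑ j, rowDiff c j * a j = ∑ j, rowDiff c j * b j) :
    matrixIdeal c = RingHom.ker (monomialMap w) := by
  have hlin (a : Fin (l + l) →₀ ℕ) : Finsupp.linearCombination ℕ w a = ∑ j, a j • w j := by
    rw [Finsupp.linearCombination_apply, Finsupp.sum_fintype _ _ (by simp)]
  refine le_antisymm (Ideal.span_le.mpr ?_) (ker_monomialMap_le w fun a b h => ?_)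
  · rintro _ ⟨ν, hν, rfl⟩
    rw [mem_matrixMonoid_iff c hc] at hν
    have hrev : ∑ j, ν j • w j = ∑ j, revExp ν j • w j := by
      refine (hw ν (revExp ν)).mpr ⟨fun j => ?_, ?_⟩
      · simp [revExp, add_comm]
      · rw [hν, ← sum_comp_rev, ← neg_zero, ← hν, ← Finset.sum_neg_distrib]
        simp [rowDiff_rev, revExp]
    rw [SetLike.mem_coe, RingHom.mem_ker, map_sub, sub_eq_zero, expMonomial_eq_monomial,
      expMonomial_eq_monomial, monomialMap_monomial, monomialMap_monomial, hlin, hlin]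
    exact congrArg (fun d => MvPolynomial.monomial d (1 : ℂ)) hrev
  · rw [hlin, hlin, hw] at h
    simpa [expMonomial_eq_monomial] using expMonomial_sub_mem_matrixIdeal c hc h.1 h.2

/-! ### The two parametrizations -/

/-- The weights of the parametrization `x_j = t_{fold j}` in the resonant case. -/
noncomputable def resonantWeight (j : Fin (l + l)) : Fin l →₀ ℕ :=
  Finsupp.single (foldIndex j) 1

/-- The weights of the parametrization `x_j = s ^ max(δ_j, 0) * t_{fold j}`, where `δ` is the
difference of the rows of the coefficient matrix. -/
noncomputable def generalWeight (j : Fin (l + l)) : Option (Fin l) →₀ ℕ :=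
  Finsupp.single (some (foldIndex j)) 1 + Finsupp.single none (rowDiff c j).toNat

theorem forall_pair_eq_iff (a b : Fin (l + l) → ℕ) :
    (∀ j, a j + a j.rev = b j + b j.rev) ↔
      ∀ i : Fin l, (∑ k, if foldIndex k = i then a k else 0) =
        ∑ k, if foldIndex k = i then b k else 0 := by
  simp only [← sum_ite_foldIndex]
  refine ⟨fun h i => ?_, fun h j => h _⟩
  have hi : foldIndex (Fin.castAdd l i) = i := by simp [foldIndex]
  rw [← hi]
  exact h (Fin.castAdd l i)

theorem resonantWeight_spec (h : ∀ i, c i 0 = c i 1) (a b : Fin (l + l) → ℕ) :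
    ∑ j, a j • resonantWeight j = ∑ j, b j • resonantWeight j ↔
      (∀ j, a j + a j.rev = b j + b j.rev) ∧
        ∑ j, rowDiff c j * a j = ∑ j, rowDiff c j * b j := by
  have h0 (j : Fin (l + l)) : rowDiff c j = 0 := by
    refine Fin.addCases (fun i => ?_) (fun i => ?_) j
    · simp [rowDiff, coeffMatrix_castAdd, h]
    · simp [rowDiff, coeffMatrix_natAdd, -Fin.natAdd_eq_addNat, h]
  rw [forall_pair_eq_iff, Finsupp.ext_iff]
  simp [h0, resonantWeight, Finsupp.finsetSum_apply, Finsupp.single_apply]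

/-- Since `max(-δ, 0) = max(δ, 0) - δ`, twice the exponent of `s` is the `δ`-weight plus a term
depending only on the pair totals. -/
theorem generalWeight_spec (a b : Fin (l + l) → ℕ) :
    ∑ j, a j • generalWeight c j = ∑ j, b j • generalWeight c j ↔
      (∀ j, a j + a j.rev = b j + b j.rev) ∧
        ∑ j, rowDiff c j * a j = ∑ j, rowDiff c j * b j := by
  have hsplit (a : Fin (l + l) → ℕ) :
      2 * ((∑ j, a j * (rowDiff c j).toNat : ℕ) : ℤ) =
        ∑ j, ((a j + a j.rev : ℕ) : ℤ) * (rowDiff c j).toNat + ∑ j, rowDiff c j * a j := by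
    have hrev : ∑ j, (a j.rev : ℤ) * (rowDiff c j).toNat =
        ∑ j, (a j : ℤ) * (-rowDiff c j).toNat := by
      rw [← sum_comp_rev]
      simp [rowDiff_rev]
    push_cast
    simp only [add_mul, Finset.sum_add_distrib]
    rw [two_mul, add_assoc, add_right_inj]
    rw [hrev, ← Finset.sum_add_distrib]
    refine Finset.sum_congr rfl fun j _ => ?_
    rcases le_total 0 (rowDiff c j) with h | h
    · simp [h, mul_comm]
    · simp [h, mul_comm]
  have hiff : ∑ j, a j • generalWeight c j = ∑ j, b j • generalWeight c j ↔
      (∀ j, a j + a j.rev = b j + b j.rev) ∧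
        ∑ j, a j * (rowDiff c j).toNat = ∑ j, b j * (rowDiff c j).toNat := by
    rw [forall_pair_eq_iff, Finsupp.ext_iff, Option.forall, and_comm]
    simp [generalWeight, Finsupp.finsetSum_apply, Finsupp.single_apply]
  rw [hiff]
  refine and_congr_right fun hpair => ?_
  have ha := hsplit a
  have hb := hsplit b
  simp only [hpair] at ha
  lia

theorem isAlgebraic_X_resonantWeight (i : Fin l) :
    IsAlgebraic (monomialMap (resonantWeight (l := l))).range
      (MvPolynomial.X i : MvPolynomial (Fin l) ℂ) := by
  have hX : monomialMap resonantWeight (MvPolynomial.X (Fin.castAdd l i)) = MvPolynomial.X i := by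
    rw [monomialMap, MvPolynomial.aeval_X, resonantWeight, foldIndex, Fin.append_left, id,
      MvPolynomial.X]
  exact isAlgebraic_algebraMap (⟨_, _, hX⟩ : (monomialMap resonantWeight).range)

theorem isAlgebraic_X_generalWeight (h : ¬ ∀ i, c i 0 = c i 1) (i : Option (Fin l)) :
    IsAlgebraic (monomialMap (generalWeight c)).range
      (MvPolynomial.X i : MvPolynomial (Option (Fin l)) ℂ) := by
  have hX (j : Fin (l + l)) : monomialMap (generalWeight c) (MvPolynomial.X j) =
      MvPolynomial.X none ^ (rowDiff c j).toNat * MvPolynomial.X (some (foldIndex j)) := by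
    rw [monomialMap, MvPolynomial.aeval_X, MvPolynomial.X_pow_eq_monomial, MvPolynomial.X,
      MvPolynomial.monomial_mul, one_mul, generalWeight, add_comm]
  have hmem (j : Fin (l + l)) : MvPolynomial.X none ^ (rowDiff c j).toNat *
      MvPolynomial.X (some (foldIndex j)) ∈ (monomialMap (generalWeight c)).range :=
    ⟨MvPolynomial.X j, hX j⟩
  have hnone : IsAlgebraic (monomialMap (generalWeight c)).range
      (MvPolynomial.X none : MvPolynomial (Option (Fin l)) ℂ) := by
    obtain ⟨j, hj⟩ : ∃ j, 0 < rowDiff c j := by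
      push Not at h
      obtain ⟨i, hi⟩ := h
      rcases lt_or_gt_of_ne hi with hlt | hlt
      · refine ⟨(Fin.castAdd l i).rev, ?_⟩
        rw [rowDiff_rev, rowDiff, coeffMatrix_castAdd, coeffMatrix_castAdd]
        lia
      · refine ⟨Fin.castAdd l i, ?_⟩
        rw [rowDiff, coeffMatrix_castAdd, coeffMatrix_castAdd]
        lia
    -- As `δ` is negative at `j.rev`, the image contains the bare `t_{fold j}` as well as `s ^ δ_j *
    -- t_{fold j}`, so `s ^ δ_j` is algebraic over it.
    have hsome := hmem j.rev
    rw [foldIndex_rev, rowDiff_rev, Int.toNat_of_nonpos (by lia), pow_zero, one_mul] at hsome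
    refine IsAlgebraic.of_pow (n := (rowDiff c j).toNat) (by lia) ?_
    refine IsAlgebraic.of_mul (mem_nonZeroDivisors_of_ne_zero
      (MvPolynomial.X_ne_zero (some (foldIndex j))))
      (isAlgebraic_algebraMap (⟨_, hsome⟩ : (monomialMap (generalWeight c)).range)) ?_
    rw [mul_comm]
    exact isAlgebraic_algebraMap (⟨_, hmem j⟩ : (monomialMap (generalWeight c)).range)
  cases i with
  | none => exact hnone
  | some i =>
    refine IsAlgebraic.of_mul (mem_nonZeroDivisors_of_ne_zero
      (pow_ne_zero (rowDiff c (Fin.castAdd l i)).toNat (MvPolynomial.X_ne_zero none)))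
      (hnone.pow _) ?_
    have := isAlgebraic_algebraMap (A := MvPolynomial (Option (Fin l)) ℂ)
      (⟨_, hmem (Fin.castAdd l i)⟩ : (monomialMap (generalWeight c)).range)
    simpa [foldIndex] using this

theorem varietyDim_matrixIdeal (hc : ∀ i, 0 ≤ c i 0 + c i 1) :
    ((∀ i, c i 0 = c i 1) →
      varietyDim (MvPolynomial.zeroLocus ℂ (matrixIdeal c)) = (l : WithBot ℕ∞)) ∧
    (¬ (∀ i, c i 0 = c i 1) →
      varietyDim (MvPolynomial.zeroLocus ℂ (matrixIdeal c)) = (l : WithBot ℕ∞) + 1) := by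
  refine ⟨fun h => ?_, fun h => ?_⟩
  · rw [matrixIdeal_eq_ker c resonantWeight hc (resonantWeight_spec c h),
      varietyDim_zeroLocus_ker_monomialMap _ isAlgebraic_X_resonantWeight]
    simp
  · rw [matrixIdeal_eq_ker c (generalWeight c) hc (generalWeight_spec c),
      varietyDim_zeroLocus_ker_monomialMap _ (isAlgebraic_X_generalWeight c h)]
    simp

end ReversalIdeal

/-! ### The Sibirsky ideal as a special case -/

namespace SystemIndex

variable {l : ℕ} (S : SystemIndex l)

/-- The exponents of a polynomial system as the coefficients `c_{i1} = p_i`, `c_{i2} = q_i`. -/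
def coeff (i : Fin l) : Fin 2 → ℤ := ![S.p i, S.q i]

theorem monoid_eq_matrixMonoid : S.monoid = matrixMonoid S.coeff := by
  ext ν
  refine exists_congr fun k => ?_
  have hfst : (S.opL ν).1 = (coeffMatrix S.coeff *ᵥ (fun j => (ν j : ℤ))) 0 := by
    simp [opL, Matrix.mulVec, dotProduct, Fin.sum_univ_add, coeffMatrix_castAdd,
      coeffMatrix_natAdd, -Fin.natAdd_eq_addNat, coeff, Prod.fst_sum, mul_comm]
  have hsnd : (S.opL ν).2 = (coeffMatrix S.coeff *ᵥ (fun j => (ν j : ℤ))) 1 := by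
    simp [opL, Matrix.mulVec, dotProduct, Fin.sum_univ_add, coeffMatrix_castAdd,
      coeffMatrix_natAdd, -Fin.natAdd_eq_addNat, coeff, Prod.snd_sum, mul_comm]
  rw [Prod.ext_iff, hfst, hsnd, funext_iff, Fin.forall_fin_two]
  rfl

theorem symmetryComponent_eq :
    S.symmetryComponent = MvPolynomial.zeroLocus ℂ (matrixIdeal S.coeff) := by
  rw [symmetryComponent, sibirskyIdeal, monoid_eq_matrixMonoid, matrixIdeal]

end SystemIndex

theorem mainTheorem3 :
    (∀ (l : ℕ) (c : Fin l → Fin 2 → ℤ), (∀ i, 0 ≤ c i 0 + c i 1) →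
      ((∀ i, c i 0 = c i 1) →
        varietyDim (MvPolynomial.zeroLocus ℂ (matrixIdeal c)) = (l : WithBot ℕ∞)) ∧
      (¬ (∀ i, c i 0 = c i 1) →
        varietyDim (MvPolynomial.zeroLocus ℂ (matrixIdeal c)) = (l : WithBot ℕ∞) + 1)) ∧
    (∀ (l : ℕ) (S : SystemIndex l),
      (S.AllResonant → varietyDim S.symmetryComponent = (l : WithBot ℕ∞)) ∧
      (¬ S.AllResonant → varietyDim S.symmetryComponent = (l : WithBot ℕ∞) + 1)) := by
  refine ⟨fun l c hc => varietyDim_matrixIdeal c hc, fun l S => ?_⟩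
  rw [S.symmetryComponent_eq]
  exact varietyDim_matrixIdeal S.coeff fun i => zero_le_one.trans (S.one_le_add i)
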